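/- Let $(\mathcal C,\mathbb E,\mathfrak s)$ be an extriangulated category satisfying Condition (WIC) (if $gf$ is an inflation then so is $f$; if $gf$ is a deflation then so is $g$). Let $\xi$ be a proper class of $\mathbb E$-triangles, i.e. a class closed under isomorphisms, finite coproducts, base change and cobase change, which contains all split $\mathbb E$-triangles and is saturated, and assume that $\mathcal C$ has enough $\xi$-projectives and enough $\xi$-injectives. Let $\mathcal W$ be a class of objects of $\mathcal C$ which is closed under finite direct sums and under hokernels of $\xi$-deflations (if $A\to B\to C\dashrightarrow$ is in $\xi$ and $B,C\in\mathcal W$, then $A\in\mathcal W$). An $\mathbb E$-triangle $A\to B\to C\dashrightarrow$ in $\xi$ is called $\mathcal C(\mathcal W,-)$-exact (resp. $\mathcal C(-,\mathcal W)$-exact) if for every $V\in\mathcal W$ the sequence $0\to\mathcal C(V,A)\to\mathcal C(V,B)\to\mathcal C(V,C)\to0$ (resp. $0\to\mathcal C(C,V)\to\mathcal C(B,V)\to\mathcal C(A,V)\to0$) is exact. A complex $\cdots\to X_1\xrightarrow{d_1}X_0\xrightarrow{d_0}A\to0$ is called $\mathcal C(\mathcal W,-)$-exact (resp. $\mathcal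 C(-,\mathcal W)$-exact) if there are $\mathcal C(\mathcal W,-)$-exact (resp. $\mathcal C(-,\mathcal W)$-exact) $\mathbb E$-triangles $K_{n+1}\xrightarrow{g_n}X_n\xrightarrow{f_n}K_n\dashrightarrow$ in $\xi$ for all $n\ge0$, with $K_0=A$, $d_0=f_0$ and $d_n=g_{n-1}f_n$ for $n\ge1$. A proper $\mathcal W(\xi)$-resolution of $A$ is a $\mathcal C(\mathcal W,-)$-exact complex $\cdots\to W_1\to W_0\to A\to0$ with all $W_n\in\mathcal W$. Let $$X\xrightarrow{x}X^0\xrightarrow{y}X^1\overset{\delta}{\dashrightarrow}\tag{1}$$ be an $\mathbb E$-triangle in $\xi$, and let $$\cdots\to W_i^0\to\cdots\to W_1^0\to W_0^0\to X^0\to0,\tag{2}$$ $$\cdots\to W_i^1\to\cdots\to W_1^1\to W_0^1\to X^1\to0\tag{3}$$ be proper $\mathcal W(\xi)$-resolutions of $X^0$ and $X^1$, respectively. Then there are an object $W$ and a proper $\mathcal W(\xi)$-resolution of $X$ of the form $$\cdots\to W_{i+1}^1\oplus W_i^0\to\cdots\to W_2^1\oplus W_1^0\to W\to X\to0\tag{4}$$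 such that the following hold. (a) There is an $\mathbb E$-triangle $W\to W_1^1\oplus W_0^0\to W_0^1\dashrightarrow$ in $\xi$. (b) If the complexes (2), (3) and the $\mathbb E$-triangle (1) are all $\mathcal C(-,\mathcal W)$-exact, then the resolution (4) is $\mathcal C(-,\mathcal W)$-exact as well. -/

import Mathlib

open CategoryTheory CategoryTheory.Limits Opposite

universe w v u

namespace Extri

section Data

variable (C : Type u) [Category.{v} C]

/-- A sequence `A ⟶ B ⟶ D` with prescribed end terms `A` and `D`. -/
structure ThreeTerm {C : Type u} [Category.{v} C] (A D : C) where
  /-- the middle term -/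
  mid : C
  /-- the first morphism -/
  x : A ⟶ mid
  /-- the second morphism -/
  y : mid ⟶ D

/-- Two sequences `A ⟶ B ⟶ D` and `A ⟶ B' ⟶ D` are equivalent if there is an isomorphism
`B ≅ B'` compatible with the identities of `A` and `D`. -/
def threeTermSetoid {C : Type u} [Category.{v} C] (A D : C) : Setoid (ThreeTerm A D) where
  r S S' := ∃ b : S.mid ≅ S'.mid, S.x ≫ b.hom = S'.x ∧ b.hom ≫ S'.y = S.y
  iseqv :=
    { refl := fun S => ⟨Iso.refl _, by simp, by simp⟩
      symm := by
        rintro S S' ⟨b, h1, h2⟩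
        exact ⟨b.symm, by simp [← h1], by simp [← h2]⟩
      trans := by
        rintro S S' S'' ⟨b, h1, h2⟩ ⟨b', h1', h2'⟩
        exact ⟨b ≪≫ b', by simp [← h1', ← h1], by simp [← h2, ← h2']⟩ }

/-- A bifunctor `E : Cᵒᵖ × C → Ab` together with a correspondence `s` which associates an
equivalence class of sequences `A ⟶ B ⟶ D` to every `δ ∈ E(D, A)`. -/
structure PreExtriangulated where
  /-- the bifunctor -/
  E : Cᵒᵖ ⥤ C ⥤ AddCommGrpCat.{w}
  /-- the correspondence -/
  s : ∀ {D A : C}, ((E.obj (op D)).obj A) → Quotient (threeTermSetoid A D)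

end Data

namespace PreExtriangulated

variable {C : Type u} [Category.{v} C] (T : PreExtriangulated.{w} C)

/-- The group `E(D, A)` of `E`-extensions. -/
abbrev Ext (D A : C) : Type w := (T.E.obj (op D)).obj A

/-- `a_* δ`. -/
def push {D A A' : C} (a : A ⟶ A') (δ : T.Ext D A) : T.Ext D A' :=
  ((T.E.obj (op D)).map a).hom δ

/-- `c^* δ`. -/
def pull {D D' A : C} (c : D' ⟶ D) (δ : T.Ext D A) : T.Ext D' A :=
  ((T.E.map c.op).app A).hom δ

/-- `s(δ) = [A ⟶ B ⟶ D]`, that is, `A ⟶ B ⟶ D` together with `δ` is an `E`-triangle. -/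
def Realizes {A B D : C} (x : A ⟶ B) (y : B ⟶ D) (δ : T.Ext D A) : Prop :=
  T.s δ = Quotient.mk (threeTermSetoid A D) ⟨B, x, y⟩

/-- A morphism which is the first morphism of an `E`-triangle. -/
def IsInflation {A B : C} (x : A ⟶ B) : Prop :=
  ∃ (D : C) (y : B ⟶ D) (δ : T.Ext D A), T.Realizes x y δ

/-- A morphism which is the second morphism of an `E`-triangle. -/
def IsDeflation {B D : C} (y : B ⟶ D) : Prop :=
  ∃ (A : C) (x : A ⟶ B) (δ : T.Ext D A), T.Realizes x y δ

/-- Condition (WIC). -/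
structure WIC : Prop where
  inflation : ∀ {A B D : C} (f : A ⟶ B) (g : B ⟶ D), T.IsInflation (f ≫ g) → T.IsInflation f
  deflation : ∀ {A B D : C} (f : A ⟶ B) (g : B ⟶ D), T.IsDeflation (f ≫ g) → T.IsDeflation g

/-- The direct sum `δ ⊕ δ' ∈ E(D ⊕ D', A ⊕ A')` of two extensions, i.e. the element with
components `δ, 0, 0, δ'`. -/
noncomputable def extSum [Preadditive C] [HasBinaryBiproducts C] {D A D' A' : C}
    (δ : T.Ext D A) (δ' : T.Ext D' A') : T.Ext (D ⊞ D') (A ⊞ A') :=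
  T.push biprod.inl (T.pull biprod.fst δ) + T.push biprod.inr (T.pull biprod.snd δ')

end PreExtriangulated

/-- An extriangulated category `(C, E, s)` on an additive category `C`. -/
structure Extriangulated (C : Type u) [Category.{v} C] [Preadditive C] [HasZeroObject C]
    [HasBinaryBiproducts C] extends PreExtriangulated.{w} C where
  /- (ET1): `E` is an additive bifunctor -/
  additive_left : E.Additive
  additive_right : ∀ D : Cᵒᵖ, (E.obj D).Additive
  /- (ET2): `s` is an additive realization -/
  realization : ∀ {A B D A' B' D' : C} {x : A ⟶ B} {y : B ⟶ D} {δ : toPreExtriangulated.Ext D A}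
    {x' : A' ⟶ B'} {y' : B' ⟶ D'} {δ' : toPreExtriangulated.Ext D' A'},
    toPreExtriangulated.Realizes x y δ → toPreExtriangulated.Realizes x' y' δ' →
    ∀ (a : A ⟶ A') (c : D ⟶ D'),
      toPreExtriangulated.push a δ = toPreExtriangulated.pull c δ' →
      ∃ b : B ⟶ B', x ≫ b = a ≫ x' ∧ b ≫ y' = y ≫ c
  realizes_zero : ∀ A D : C,
    toPreExtriangulated.Realizes (biprod.inl : A ⟶ A ⊞ D) (biprod.snd : A ⊞ D ⟶ D) 0
  realizes_sum : ∀ {A B D A' B' D' : C} {x : A ⟶ B} {y : B ⟶ D} {δ : toPreExtriangulated.Ext D A}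
    {x' : A' ⟶ B'} {y' : B' ⟶ D'} {δ' : toPreExtriangulated.Ext D' A'},
    toPreExtriangulated.Realizes x y δ → toPreExtriangulated.Realizes x' y' δ' →
    toPreExtriangulated.Realizes (biprod.map x x') (biprod.map y y')
      (toPreExtriangulated.extSum δ δ')
  /- (ET3) and its dual -/
  et3 : ∀ {A B D A' B' D' : C} {x : A ⟶ B} {y : B ⟶ D} {δ : toPreExtriangulated.Ext D A}
    {x' : A' ⟶ B'} {y' : B' ⟶ D'} {δ' : toPreExtriangulated.Ext D' A'},
    toPreExtriangulated.Realizes x y δ → toPreExtriangulated.Realizes x' y' δ' →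
    ∀ (a : A ⟶ A') (b : B ⟶ B'), x ≫ b = a ≫ x' →
      ∃ c : D ⟶ D', b ≫ y' = y ≫ c ∧
        toPreExtriangulated.push a δ = toPreExtriangulated.pull c δ'
  et3_op : ∀ {A B D A' B' D' : C} {x : A ⟶ B} {y : B ⟶ D} {δ : toPreExtriangulated.Ext D A}
    {x' : A' ⟶ B'} {y' : B' ⟶ D'} {δ' : toPreExtriangulated.Ext D' A'},
    toPreExtriangulated.Realizes x y δ → toPreExtriangulated.Realizes x' y' δ' →
    ∀ (b : B ⟶ B') (c : D ⟶ D'), b ≫ y' = y ≫ c →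
      ∃ a : A ⟶ A', x ≫ b = a ≫ x' ∧
        toPreExtriangulated.push a δ = toPreExtriangulated.pull c δ'
  /- (ET4) and its dual -/
  et4 : ∀ {A B D G F : C} {f : A ⟶ B} {f' : B ⟶ D} {δ : toPreExtriangulated.Ext D A}
    {g : B ⟶ G} {g' : G ⟶ F} {δ' : toPreExtriangulated.Ext F B},
    toPreExtriangulated.Realizes f f' δ → toPreExtriangulated.Realizes g g' δ' →
    ∃ (H : C) (h' : G ⟶ H) (d : D ⟶ H) (e : H ⟶ F) (δ'' : toPreExtriangulated.Ext H A),
      g ≫ h' = f' ≫ d ∧ h' ≫ e = g' ∧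
      toPreExtriangulated.Realizes (f ≫ g) h' δ'' ∧
      toPreExtriangulated.Realizes d e (toPreExtriangulated.push f' δ') ∧
      toPreExtriangulated.pull d δ'' = δ ∧
      toPreExtriangulated.push f δ'' = toPreExtriangulated.pull e δ'
  et4_op : ∀ {A B D G F : C} {f' : D ⟶ B} {f : B ⟶ A} {δ : toPreExtriangulated.Ext A D}
    {g' : F ⟶ G} {g : G ⟶ B} {δ' : toPreExtriangulated.Ext B F},
    toPreExtriangulated.Realizes f' f δ → toPreExtriangulated.Realizes g' g δ' →
    ∃ (H : C) (h' : H ⟶ G) (d : H ⟶ D) (e : F ⟶ H) (δ'' : toPreExtriangulated.Ext A H),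
      h' ≫ g = d ≫ f' ∧ e ≫ h' = g' ∧
      toPreExtriangulated.Realizes h' (g ≫ f) δ'' ∧
      toPreExtriangulated.Realizes e d (toPreExtriangulated.pull f' δ') ∧
      toPreExtriangulated.push d δ'' = δ ∧
      toPreExtriangulated.pull f δ'' = toPreExtriangulated.push e δ'

variable {C : Type u} [Category.{v} C] [Preadditive C] [HasZeroObject C] [HasBinaryBiproducts C]

/-- A proper class of `E`-triangles. Closure under the empty coproduct is a special case of
`split_mem`. -/
structure ProperClass (T : Extriangulated.{w} C) where
  /-- membership in the class -/
  mem : ∀ {A B D : C} (_ : A ⟶ B) (_ : B ⟶ D) (_ : T.Ext D A), Prop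
  realizes : ∀ {A B D : C} {x : A ⟶ B} {y : B ⟶ D} {δ : T.Ext D A},
    mem x y δ → T.Realizes x y δ
  iso_closed : ∀ {A B D A' B' D' : C} {x : A ⟶ B} {y : B ⟶ D} {δ : T.Ext D A}
    {x' : A' ⟶ B'} {y' : B' ⟶ D'} {δ' : T.Ext D' A'},
    mem x y δ → T.Realizes x' y' δ' →
    ∀ (a : A ≅ A') (b : B ≅ B') (c : D ≅ D'), x ≫ b.hom = a.hom ≫ x' →
      y ≫ c.hom = b.hom ≫ y' → T.push a.hom δ = T.pull c.hom δ' → mem x' y' δ'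
  sum_mem : ∀ {A B D A' B' D' : C} {x : A ⟶ B} {y : B ⟶ D} {δ : T.Ext D A}
    {x' : A' ⟶ B'} {y' : B' ⟶ D'} {δ' : T.Ext D' A'},
    mem x y δ → mem x' y' δ' → mem (biprod.map x x') (biprod.map y y') (T.extSum δ δ')
  split_mem : ∀ {A B D : C} {x : A ⟶ B} {y : B ⟶ D}, T.Realizes x y 0 → mem x y 0
  base_change : ∀ {A B D B' D' : C} {x : A ⟶ B} {y : B ⟶ D} {δ : T.Ext D A}
    {x' : A ⟶ B'} {y' : B' ⟶ D'} (c : D' ⟶ D),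
    mem x y δ → T.Realizes x' y' (T.pull c δ) → mem x' y' (T.pull c δ)
  cobase_change : ∀ {A B D A' B' : C} {x : A ⟶ B} {y : B ⟶ D} {δ : T.Ext D A}
    {x' : A' ⟶ B'} {y' : B' ⟶ D} (a : A ⟶ A'),
    mem x y δ → T.Realizes x' y' (T.push a δ) → mem x' y' (T.push a δ)
  saturated : ∀ {A₁ B₁ A₂ B₂ D M : C}
    {x₁ : A₁ ⟶ B₁} {y₁ : B₁ ⟶ D} {δ₁ : T.Ext D A₁}
    {x₂ : A₂ ⟶ B₂} {y₂ : B₂ ⟶ D} {δ₂ : T.Ext D A₂}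
    {m₁ : A₁ ⟶ M} {e₁ : M ⟶ B₂} {m₂ : A₂ ⟶ M} {e₂ : M ⟶ B₁},
    T.Realizes x₁ y₁ δ₁ → T.Realizes x₂ y₂ δ₂ →
    m₂ ≫ e₁ = x₂ → m₁ ≫ e₂ = x₁ → e₂ ≫ y₁ = e₁ ≫ y₂ →
    T.Realizes m₁ e₁ (T.pull y₂ δ₁) → T.Realizes m₂ e₂ (T.pull y₁ δ₂) →
    mem x₂ y₂ δ₂ → mem m₁ e₁ (T.pull y₂ δ₁) → mem x₁ y₁ δ₁

/-- `0 ⟶ C(P, A) ⟶ C(P, B) ⟶ C(P, D) ⟶ 0` is exact. -/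
def CovExactAt (P : C) {A B D : C} (x : A ⟶ B) (y : B ⟶ D) : Prop :=
  Function.Injective (fun h : P ⟶ A => h ≫ x) ∧
  Function.Exact (fun h : P ⟶ A => h ≫ x) (fun h : P ⟶ B => h ≫ y) ∧
  Function.Surjective (fun h : P ⟶ B => h ≫ y)

/-- `0 ⟶ C(D, I) ⟶ C(B, I) ⟶ C(A, I) ⟶ 0` is exact. -/
def ContraExactAt (I : C) {A B D : C} (x : A ⟶ B) (y : B ⟶ D) : Prop :=
  Function.Injective (fun h : D ⟶ I => y ≫ h) ∧
  Function.Exact (fun h : D ⟶ I => y ≫ h) (fun h : B ⟶ I => x ≫ h) ∧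
  Function.Surjective (fun h : B ⟶ I => x ≫ h)

namespace ProperClass

variable {T : Extriangulated.{w} C} (ξ : ProperClass T)

/-- `ξ`-projective objects. -/
def IsProjective (P : C) : Prop :=
  ∀ {A B D : C} (x : A ⟶ B) (y : B ⟶ D) (δ : T.Ext D A), ξ.mem x y δ → CovExactAt P x y

/-- `ξ`-injective objects. -/
def IsInjective (I : C) : Prop :=
  ∀ {A B D : C} (x : A ⟶ B) (y : B ⟶ D) (δ : T.Ext D A), ξ.mem x y δ → ContraExactAt I x y

/-- There are enough `ξ`-projectives. -/
def EnoughProjectives : Prop :=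
  ∀ A : C, ∃ (K P : C) (i : K ⟶ P) (p : P ⟶ A) (δ : T.Ext A K), ξ.mem i p δ ∧ ξ.IsProjective P

/-- There are enough `ξ`-injectives. -/
def EnoughInjectives : Prop :=
  ∀ A : C, ∃ (I K : C) (i : A ⟶ I) (p : I ⟶ K) (δ : T.Ext K A), ξ.mem i p δ ∧ ξ.IsInjective I

/-- `𝒲` is closed under hokernels of `ξ`-deflations. -/
def ClosedUnderHokernels (𝒲 : ObjectProperty C) : Prop :=
  ∀ {A B D : C} (x : A ⟶ B) (y : B ⟶ D) (δ : T.Ext D A), ξ.mem x y δ → 𝒲 B → 𝒲 D → 𝒲 A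

/-- A `C(𝒲, -)`-exact `E`-triangle in `ξ`. -/
def CovExact (𝒲 : ObjectProperty C) {A B D : C} (x : A ⟶ B) (y : B ⟶ D) (δ : T.Ext D A) : Prop :=
  ξ.mem x y δ ∧ ∀ W : C, 𝒲 W → CovExactAt W x y

/-- A `C(-, 𝒲)`-exact `E`-triangle in `ξ`. -/
def ContraExact (𝒲 : ObjectProperty C) {A B D : C} (x : A ⟶ B) (y : B ⟶ D)
    (δ : T.Ext D A) : Prop :=
  ξ.mem x y δ ∧ ∀ W : C, 𝒲 W → ContraExactAt W x y

end ProperClass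

/-- `𝒲` is closed under finite direct sums. -/
def ClosedUnderSums (𝒲 : ObjectProperty C) : Prop :=
  (∀ Z : C, IsZero Z → 𝒲 Z) ∧ ∀ A B : C, 𝒲 A → 𝒲 B → 𝒲 (A ⊞ B)

/-- A complex `⋯ ⟶ X 1 ⟶ X 0 ⟶ A ⟶ 0`. -/
structure AugComplex (X : ℕ → C) (A : C) where
  /-- the differentials -/
  d : ∀ n, X (n + 1) ⟶ X n
  /-- the augmentation -/
  ε : X 0 ⟶ A
  d_comp_d : ∀ n, d (n + 1) ≫ d n = 0
  d_comp_ε : d 0 ≫ ε = 0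

namespace AugComplex

variable {T : Extriangulated.{w} C}

/-- The complex `⋯ ⟶ X 1 ⟶ X 0 ⟶ A ⟶ 0` is spliced from `E`-triangles
`K 0 ⟶ X 0 ⟶ A` and `K (n + 1) ⟶ X (n + 1) ⟶ K n` satisfying `Q`. -/
def SplicedFrom (Q : ∀ {A B D : C} (_ : A ⟶ B) (_ : B ⟶ D) (_ : T.Ext D A), Prop)
    {X : ℕ → C} {A : C} (R : AugComplex X A) : Prop :=
  ∃ (K : ℕ → C) (g : ∀ n, K n ⟶ X n) (f : ∀ n, X (n + 1) ⟶ K n)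
    (δ₀ : T.Ext A (K 0)) (δ : ∀ n, T.Ext (K n) (K (n + 1))),
    Q (g 0) R.ε δ₀ ∧ (∀ n, Q (g (n + 1)) (f n) (δ n)) ∧ ∀ n, R.d n = f n ≫ g n

/-- The `ξ`-exact complex is `C(𝒲, -)`-exact. -/
def CovExact (ξ : ProperClass T) (𝒲 : ObjectProperty C) {X : ℕ → C} {A : C}
    (R : AugComplex X A) : Prop :=
  R.SplicedFrom (T := T) (fun x y δ => ξ.CovExact 𝒲 x y δ)

/-- The `ξ`-exact complex is `C(-, 𝒲)`-exact. -/
def ContraExact (ξ : ProperClass T) (𝒲 : ObjectProperty C) {X : ℕ → C} {A : C}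
    (R : AugComplex X A) : Prop :=
  R.SplicedFrom (T := T) (fun x y δ => ξ.ContraExact 𝒲 x y δ)

/-- A proper `𝒲(ξ)`-resolution of `A`. -/
def IsProperResolution (ξ : ProperClass T) (𝒲 : ObjectProperty C) {X : ℕ → C} {A : C}
    (R : AugComplex X A) : Prop :=
  (∀ n, 𝒲 (X n)) ∧ R.CovExact ξ 𝒲

end AugComplex

/-- The objects `W, W₁ 2 ⊕ W₀ 1, W₁ 3 ⊕ W₀ 2, …`. -/
noncomputable def shiftedTerms (W : C) (W₁ W₀ : ℕ → C) : ℕ → C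
  | 0 => W
  | n + 1 => W₁ (n + 2) ⊞ W₀ (n + 1)

end Extri

/-! Let `K₁ n` and `K₀ n` be the syzygies of the two given resolutions. The pullback `M` of `X₀ ⟶
X₁` and `W₁ 0 ⟶ X₁` sits in E-triangles `X ⟶ M ⟶ W₁ 0` and `K₁ 0 ⟶ M ⟶ X₀`. The horseshoe lemma on
the second one covers `M` by `W₁ 1 ⊞ W₀ 0` with hokernel `N`, and places `N` in `K₁ 1 ⟶ N ⟶ K₀ 0`.
The object `W` is the hokernel of the composite `W₁ 1 ⊞ W₀ 0 ⟶ M ⟶ W₁ 0`. This is (a), it puts `W`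
in `𝒲`, and dual (ET4) exhibits `N ⟶ W ⟶ X` as the base change along `X ⟶ M` of the triangle
covering `M`. Iterated horseshoes then resolve `N`.

Each triangle of the new resolution arises from the given ones by base change and composition of
deflations. Both operations preserve exactness against `𝒲` in either variable, so `BiExact` handles
properness and (b) together. Composites stay in `ξ` by saturation (`mem_comp`). -/

namespace Extri

/-! ### Functoriality of extensions and their realizations. -/

namespace PreExtriangulated

variable {C : Type u} [Category.{v} C] (T : PreExtriangulated.{w} C)

@[simp]
lemma push_id {D A : C} (δ : T.Ext D A) : T.push (𝟙 A) δ = δ := by simp [push]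

@[simp]
lemma pull_id {D A : C} (δ : T.Ext D A) : T.pull (𝟙 D) δ = δ := by simp [pull]

lemma push_comp {D A A' A'' : C} (a : A ⟶ A') (a' : A' ⟶ A'') (δ : T.Ext D A) :
    T.push (a ≫ a') δ = T.push a' (T.push a δ) := by simp [push]

lemma pull_comp {D D' D'' A : C} (c' : D'' ⟶ D') (c : D' ⟶ D) (δ : T.Ext D A) :
    T.pull (c' ≫ c) δ = T.pull c' (T.pull c δ) := by simp [pull]

lemma push_pull {D D' A A' : C} (a : A ⟶ A') (c : D' ⟶ D) (δ : T.Ext D A) :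
    T.push a (T.pull c δ) = T.pull c (T.push a δ) := by
  have h := (T.E.map c.op).naturality a
  exact (ConcreteCategory.congr_hom h δ).symm

@[simp]
lemma push_add {D A A' : C} (a : A ⟶ A') (δ δ' : T.Ext D A) :
    T.push a (δ + δ') = T.push a δ + T.push a δ' := map_add _ _ _

@[simp]
lemma push_zero {D A A' : C} (a : A ⟶ A') : T.push a (0 : T.Ext D A) = 0 := map_zero _

@[simp]
lemma pull_zero {D D' A : C} (c : D' ⟶ D) : T.pull c (0 : T.Ext D A) = 0 := map_zero _

variable {T}

/-- Every extension is realized by some sequence. -/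
lemma exists_realizes {D A : C} (δ : T.Ext D A) :
    ∃ (B : C) (x : A ⟶ B) (y : B ⟶ D), T.Realizes x y δ := by
  obtain ⟨⟨B, x, y⟩, h⟩ := Quotient.exists_rep (T.s δ)
  exact ⟨B, x, y, h.symm⟩

/-- Two realizations of the same extension are equivalent. -/
lemma Realizes.exists_iso {A B B' D : C} {x : A ⟶ B} {y : B ⟶ D} {x' : A ⟶ B'} {y' : B' ⟶ D}
    {δ : T.Ext D A} (h : T.Realizes x y δ) (h' : T.Realizes x' y' δ) :
    ∃ b : B ≅ B', x ≫ b.hom = x' ∧ b.hom ≫ y' = y :=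
  Quotient.exact (s := threeTermSetoid A D) (h.symm.trans h')

lemma Realizes.of_mid_iso {A B B' D : C} {x : A ⟶ B} {y : B ⟶ D} {x' : A ⟶ B'} {y' : B' ⟶ D}
    {δ : T.Ext D A} (h : T.Realizes x y δ) (b : B ≅ B') (hx : x ≫ b.hom = x')
    (hy : b.hom ≫ y' = y) : T.Realizes x' y' δ :=
  Eq.trans h (Quotient.sound (s := threeTermSetoid A D) ⟨b, hx, hy⟩)

end PreExtriangulated

open PreExtriangulated
open scoped ZeroObject

variable {C : Type u} [Category.{v} C] [Preadditive C]

/-- A morphism with a one-sided inverse up to square-zero endomorphisms on both sides is an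
isomorphism. -/
lemma isIso_of_comp_sub_id_sq_zero {A B : C} (u : A ⟶ B) (v : B ⟶ A)
    (h : (u ≫ v - 𝟙 A) ≫ (u ≫ v - 𝟙 A) = 0) (h' : (v ≫ u - 𝟙 B) ≫ (v ≫ u - 𝟙 B) = 0) :
    IsIso u := by
  -- If `n = u ≫ v - 𝟙 A` squares to zero, then `𝟙 A + n` has inverse `𝟙 A - n = 2 • 𝟙 A - u ≫ v`.
  have h₁ : u ≫ (v ≫ (2 • 𝟙 A - u ≫ v)) = 𝟙 A := by
    simp only [Preadditive.comp_sub, Preadditive.sub_comp, two_smul, Preadditive.comp_add,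
      Category.comp_id, Category.id_comp, Category.assoc] at h ⊢
    rw [sub_eq_zero] at h
    rw [add_sub_assoc, ← neg_sub (u ≫ v ≫ u ≫ v), h]
    abel
  have h₂ : ((2 • 𝟙 B - v ≫ u) ≫ v) ≫ u = 𝟙 B := by
    simp only [Preadditive.comp_sub, Preadditive.sub_comp, two_smul, Preadditive.add_comp,
      Category.comp_id, Category.id_comp, Category.assoc] at h' ⊢
    rw [sub_eq_zero] at h'
    rw [add_sub_assoc, ← neg_sub (v ≫ u ≫ v ≫ u), h']
    abel
  have := IsSplitMono.mk' ⟨_, h₁⟩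
  have := IsSplitEpi.mk' ⟨_, h₂⟩
  exact isIso_of_mono_of_isSplitEpi u

variable [HasZeroObject C] [HasBinaryBiproducts C] {T : Extriangulated.{w} C}

namespace Extriangulated

lemma add_push {D A A' : C} (a a' : A ⟶ A') (δ : T.Ext D A) :
    T.push (a + a') δ = T.push a δ + T.push a' δ := by
  have := T.additive_right (op D)
  simp [push, Functor.map_add]

lemma add_pull {D D' A : C} (c c' : D' ⟶ D) (δ : T.Ext D A) :
    T.pull (c + c') δ = T.pull c δ + T.pull c' δ := by
  have := T.additive_left
  simp [pull, Functor.map_add]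

@[simp]
lemma zero_push {D A A' : C} (δ : T.Ext D A) : T.push (0 : A ⟶ A') δ = 0 := by
  simpa using add_push (0 : A ⟶ A') 0 δ

@[simp]
lemma zero_pull {D D' A : C} (δ : T.Ext D A) : T.pull (0 : D' ⟶ D) δ = 0 := by
  simpa using add_pull (0 : D' ⟶ D) 0 δ

lemma sub_push {D A A' : C} (a a' : A ⟶ A') (δ : T.Ext D A) :
    T.push (a - a') δ = T.push a δ - T.push a' δ := by
  rw [eq_sub_iff_add_eq, ← add_push, sub_add_cancel]

/-! ### Exact Hom–E sequences, by comparison with split triangles. -/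

section Exactness

variable {A B D : C} {x : A ⟶ B} {y : B ⟶ D} {δ : T.Ext D A}

lemma comp_eq_zero (h : T.Realizes x y δ) : x ≫ y = 0 := by
  obtain ⟨c, hc, -⟩ := T.et3 (T.realizes_zero A (0 : C)) h (𝟙 A) (biprod.fst ≫ x) (by simp)
  have : (biprod.inl : A ⟶ A ⊞ (0 : C)) ≫ (biprod.fst ≫ x) ≫ y = 0 := by rw [hc]; simp
  simpa using this

lemma push_inflation (h : T.Realizes x y δ) : T.push x δ = 0 := by
  obtain ⟨c, -, hc⟩ := T.et3 h (T.realizes_zero B (0 : C)) x biprod.inl rfl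
  simpa using hc

lemma pull_deflation (h : T.Realizes x y δ) : T.pull y δ = 0 := by
  obtain ⟨a, -, ha⟩ := T.et3_op (T.realizes_zero (0 : C) B) h biprod.snd y rfl
  simpa using ha.symm

lemma exists_lift (h : T.Realizes x y δ) {Z : C} (t : Z ⟶ B) (ht : t ≫ y = 0) :
    ∃ l : Z ⟶ A, l ≫ x = t := by
  obtain ⟨a, ha, -⟩ := T.et3_op (T.realizes_zero Z (0 : C)) h (biprod.fst ≫ t) 0 (by simp [ht])
  exact ⟨a, by simpa using ha.symm⟩

lemma exists_desc (h : T.Realizes x y δ) {Z : C} (t : B ⟶ Z) (ht : x ≫ t = 0) :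
    ∃ l : D ⟶ Z, y ≫ l = t := by
  obtain ⟨c, hc, -⟩ := T.et3 h (T.realizes_zero (0 : C) Z) 0 (t ≫ biprod.inr)
    (by simp [reassoc_of% ht])
  exact ⟨c, by simpa using hc.symm⟩

lemma exists_lift_iff (h : T.Realizes x y δ) {Z : C} (t : Z ⟶ D) :
    (∃ l : Z ⟶ B, l ≫ y = t) ↔ T.pull t δ = 0 := by
  constructor
  · rintro ⟨l, rfl⟩
    rw [pull_comp, pull_deflation h, pull_zero]
  · intro ht
    obtain ⟨b, -, hb⟩ := T.realization (T.realizes_zero A Z) h (𝟙 A) t (by simp [ht])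
    exact ⟨biprod.inr ≫ b, by simp [hb]⟩

lemma exists_extend_iff (h : T.Realizes x y δ) {Z : C} (t : A ⟶ Z) :
    (∃ l : B ⟶ Z, x ≫ l = t) ↔ T.push t δ = 0 := by
  constructor
  · rintro ⟨l, rfl⟩
    rw [push_comp, push_inflation h, push_zero]
  · intro ht
    obtain ⟨b, hb, -⟩ := T.realization h (T.realizes_zero Z D) t (𝟙 D) (by simp [ht])
    exact ⟨b ≫ biprod.fst, by simp [reassoc_of% hb]⟩

/-- Exactness in the middle is automatic, and the obstruction to lifting `t` along `y` is `t^* δ`.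
-/
lemma covExactAt_iff (h : T.Realizes x y δ) (P : C) :
    CovExactAt P x y ↔ (∀ t : P ⟶ A, t ≫ x = 0 → t = 0) ∧ ∀ t : P ⟶ D, T.pull t δ = 0 := by
  constructor
  · rintro ⟨h₁, -, h₃⟩
    exact ⟨fun t ht => h₁ (by simpa using ht), fun t => (exists_lift_iff h t).1 (h₃ t)⟩
  · rintro ⟨h₁, h₃⟩
    refine ⟨fun s t hst => ?_, fun t => ⟨exists_lift h t, ?_⟩,
      fun t => (exists_lift_iff h t).2 (h₃ t)⟩
    · exact sub_eq_zero.1 (h₁ _ (by simpa [sub_eq_zero] using hst))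
    · rintro ⟨l, rfl⟩
      simp [comp_eq_zero h]

lemma contraExactAt_iff (h : T.Realizes x y δ) (I : C) :
    ContraExactAt I x y ↔ (∀ t : D ⟶ I, y ≫ t = 0 → t = 0) ∧ ∀ t : A ⟶ I, T.push t δ = 0 := by
  constructor
  · rintro ⟨h₁, -, h₃⟩
    exact ⟨fun t ht => h₁ (by simpa using ht), fun t => (exists_extend_iff h t).1 (h₃ t)⟩
  · rintro ⟨h₁, h₃⟩
    refine ⟨fun s t hst => ?_, fun t => ⟨exists_desc h t, ?_⟩,
      fun t => (exists_extend_iff h t).2 (h₃ t)⟩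
    · exact sub_eq_zero.1 (h₁ _ (by simpa [sub_eq_zero] using hst))
    · rintro ⟨l, rfl⟩
      simp [reassoc_of% comp_eq_zero h]

end Exactness

/-! ### Isomorphisms of E-triangles. -/

section Isomorphisms

variable {A B D A' B' D' : C} {x : A ⟶ B} {y : B ⟶ D} {δ : T.Ext D A}
  {x' : A' ⟶ B'} {y' : B' ⟶ D'} {δ' : T.Ext D' A'}

/-- `n - 𝟙 B` vanishes on `x`, so it factors through `y`, which it also kills. This plays the role
of the five lemma. -/
lemma endo_sub_id_sq_zero (h : T.Realizes x y δ) (n : B ⟶ B) (h₁ : x ≫ n = x)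
    (h₂ : n ≫ y = y) : (n - 𝟙 B) ≫ (n - 𝟙 B) = 0 := by
  obtain ⟨s, hs⟩ := exists_desc h (n - 𝟙 B) (by simp [h₁])
  nth_rw 2 [← hs]
  simp [reassoc_of% h₂]

/-- Extensions which correspond to each other under isomorphisms of the end terms have isomorphic
realizations. -/
lemma exists_mid_iso (h : T.Realizes x y δ) (h' : T.Realizes x' y' δ') (a : A ≅ A') (c : D ≅ D')
    (hac : T.push a.hom δ = T.pull c.hom δ') :
    ∃ b : B ≅ B', x ≫ b.hom = a.hom ≫ x' ∧ b.hom ≫ y' = y ≫ c.hom := by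
  obtain ⟨b, hb₁, hb₂⟩ := T.realization h h' a.hom c.hom hac
  have hac' : T.push a.inv δ' = T.pull c.inv δ := by
    have : T.pull c.inv (T.push a.inv (T.push a.hom δ)) =
        T.pull c.inv (T.push a.inv (T.pull c.hom δ')) := by rw [hac]
    rw [← push_comp, push_pull, ← pull_comp] at this
    simpa using this.symm
  obtain ⟨b', hb₁', hb₂'⟩ := T.realization h' h a.inv c.inv hac'
  have : IsIso b := isIso_of_comp_sub_id_sq_zero b b'
    (endo_sub_id_sq_zero h _ (by simp [reassoc_of% hb₁, hb₁'])
      (by simp [hb₂', reassoc_of% hb₂]))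
    (endo_sub_id_sq_zero h' _ (by simp [reassoc_of% hb₁', hb₁])
      (by simp [hb₂, reassoc_of% hb₂']))
  exact ⟨asIso b, hb₁, hb₂⟩

/-- The class of `E`-triangles is closed under isomorphisms. -/
lemma realizes_of_iso (h : T.Realizes x y δ) (a : A ≅ A') (b : B ≅ B') (c : D ≅ D')
    (hx : x ≫ b.hom = a.hom ≫ x') (hy : y ≫ c.hom = b.hom ≫ y')
    (hac : T.push a.hom δ = T.pull c.hom δ') : T.Realizes x' y' δ' := by
  obtain ⟨B'', x'', y'', h''⟩ := exists_realizes δ'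
  obtain ⟨b'', h₁, h₂⟩ := exists_mid_iso h h'' a c hac
  refine h''.of_mid_iso (b''.symm ≪≫ b) ?_ ?_
  · rw [← cancel_epi a.hom, ← hx, ← reassoc_of% h₁]
    simp
  · rw [← cancel_epi b''.hom, h₂, hy]
    simp

/-- An isomorphism between the last terms of two `E`-triangles which is compatible with the
deflations extends to the first terms. -/
lemma exists_left_iso (h : T.Realizes x y δ) {x' : A' ⟶ B} {y' : B ⟶ D'}
    (h' : T.Realizes x' y' δ') (c : D ≅ D') (hc : y ≫ c.hom = y') :
    ∃ a : A ≅ A', a.hom ≫ x' = x ∧ T.push a.hom δ = T.pull c.hom δ' := by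
  obtain ⟨a, ha₁, ha₂⟩ := T.et3_op h h' (𝟙 B) c.hom (by simp [hc])
  obtain ⟨a', ha₁', ha₂'⟩ := T.et3_op h' h (𝟙 B) c.inv (by simp [← hc])
  rw [Category.comp_id] at ha₁ ha₁'
  -- Since `n - 𝟙 A` pushes `δ` to zero, it extends along `x`; it is also killed by `x`, hence has
  -- square zero.
  have key : ∀ {A D : C} {x : A ⟶ B} {y : B ⟶ D} {δ : T.Ext D A} (_ : T.Realizes x y δ)
      (n : A ⟶ A), n ≫ x = x → T.push n δ = δ → (n - 𝟙 A) ≫ (n - 𝟙 A) = 0 := by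
    intro A D x y δ h n h₁ h₂
    obtain ⟨s, hs⟩ := (exists_extend_iff h (n - 𝟙 A)).2 (by simp [sub_push, h₂])
    nth_rw 2 [← hs]
    simp [reassoc_of% h₁]
  have : IsIso a := isIso_of_comp_sub_id_sq_zero a a'
    (key h _ (by simp [← ha₁, ← ha₁'])
      (by rw [push_comp, ha₂, push_pull, ha₂', ← pull_comp]; simp))
    (key h' _ (by simp [← ha₁, ← ha₁'])
      (by rw [push_comp, ha₂', push_pull, ha₂, ← pull_comp]; simp))
  exact ⟨asIso a, ha₁.symm, ha₂⟩

end Isomorphisms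

/-! ### Split triangles and pullback squares. -/

/-- The split sequence `D ⟶ A ⊞ D ⟶ A` realizes the zero extension. -/
lemma realizes_inr_fst (A D : C) :
    T.Realizes (biprod.inr : D ⟶ A ⊞ D) (biprod.fst : A ⊞ D ⟶ A) 0 :=
  (T.realizes_zero D A).of_mid_iso (biprod.braiding D A) (by ext <;> simp) (by simp)

/-- The sequence `D' ⟶ D ⊞ D' ⟶ D` given by the graph of `c` is a split `E`-triangle. -/
lemma realizes_graph {D D' : C} (c : D' ⟶ D) :
    T.Realizes (biprod.lift c (𝟙 D')) (biprod.desc (𝟙 D) (-c)) 0 := by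
  refine (T.realizes_zero D' D).of_mid_iso
    { hom := biprod.desc (biprod.lift c (𝟙 D')) (biprod.lift (𝟙 D) 0)
      inv := biprod.lift biprod.snd (biprod.desc (𝟙 D) (-c))
      hom_inv_id := ?_
      inv_hom_id := ?_ } ?_ ?_
  · ext <;> simp
  · ext <;> simp
  · simp
  · ext <;> simp

/-- The direct sum of an `E`-triangle `A ⟶ B ⟶ D` and the `E`-triangle `0 ⟶ Z ⟶ Z`. -/
lemma realizes_sum_id {A B D : C} {x : A ⟶ B} {y : B ⟶ D} {δ : T.Ext D A}
    (h : T.Realizes x y δ) (Z : C) :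
    T.Realizes (x ≫ biprod.inl) (biprod.map y (𝟙 Z)) (T.pull biprod.fst δ) := by
  have hZ : T.Realizes (0 : (0 : C) ⟶ Z) (𝟙 Z) 0 :=
    (T.realizes_zero (0 : C) Z).of_mid_iso
      { hom := biprod.snd
        inv := biprod.inr
        hom_inv_id := by ext; simp
        inv_hom_id := by simp } (by simp) (by simp)
  refine realizes_of_iso (T.realizes_sum h hZ)
    { hom := biprod.fst
      inv := biprod.inl
      hom_inv_id := by ext; simp
      inv_hom_id := by simp } (Iso.refl _) (Iso.refl _) ?_ (by simp) ?_
  · ext <;> simp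
  · simp [extSum, ← push_comp]

/-- The cokernel of the restriction of an inflation from a direct sum to one summand. -/
lemma exists_quotient_by_summand {A₁ A₂ S M D B₁ : C} {i : A₂ ⟶ S} {q : S ⟶ A₁}
    (hiq : T.Realizes i q 0) {r : S ⟶ A₂} (hr : i ≫ r = 𝟙 A₂) {m : S ⟶ M} {p : M ⟶ D}
    {μ : T.Ext D S} (hμ : T.Realizes m p μ) {x₁ : A₁ ⟶ B₁} {y₁ : B₁ ⟶ D}
    (h₁ : T.Realizes x₁ y₁ (T.push q μ)) :
    ∃ e : M ⟶ B₁, m ≫ e = q ≫ x₁ ∧ e ≫ y₁ = p ∧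
      T.Realizes (i ≫ m) e (T.pull y₁ (T.push r μ)) := by
  obtain ⟨H, h', d, e, δ'', hd, he, hδ'', hde, -, hpush⟩ := T.et4 hiq hμ
  obtain ⟨b, hb₁, hb₂⟩ := hde.exists_iso h₁
  refine ⟨h' ≫ b.hom, by rw [reassoc_of% hd, hb₁], by rw [Category.assoc, hb₂, he], ?_⟩
  refine realizes_of_iso hδ'' (Iso.refl _) (Iso.refl _) b (by simp) (by simp) ?_
  -- `δ''` is recovered from `i_* δ'' = e^* μ` by applying the retraction `r`.
  rw [← T.pull_comp, hb₂, ← T.push_pull, ← hpush, ← push_comp, hr]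
  rfl

/-- Two `E`-triangles with the same last term fit into a square whose rows and columns are
base changes of each other. -/
lemma exists_pullback_square {A₁ B₁ A₂ B₂ D : C} {x₁ : A₁ ⟶ B₁} {y₁ : B₁ ⟶ D}
    {δ₁ : T.Ext D A₁} {x₂ : A₂ ⟶ B₂} {y₂ : B₂ ⟶ D} {δ₂ : T.Ext D A₂}
    (h₁ : T.Realizes x₁ y₁ δ₁) (h₂ : T.Realizes x₂ y₂ δ₂) :
    ∃ (M : C) (m₁ : A₁ ⟶ M) (e₁ : M ⟶ B₂) (m₂ : A₂ ⟶ M) (e₂ : M ⟶ B₁),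
      m₂ ≫ e₁ = x₂ ∧ m₁ ≫ e₂ = x₁ ∧ e₂ ≫ y₁ = e₁ ≫ y₂ ∧
      T.Realizes m₁ e₁ (T.pull y₂ δ₁) ∧ T.Realizes m₂ e₂ (T.pull y₁ δ₂) := by
  -- Realize the extension of `D` by `A₁ ⊞ A₂` with components `δ₁, δ₂`; dividing out one summand of
  -- `M` at a time gives `B₁` and `B₂`.
  obtain ⟨M, m, p, hμ⟩ := exists_realizes (T.push biprod.inl δ₁ + T.push biprod.inr δ₂)
  have hfst : T.push biprod.fst (T.push biprod.inl δ₁ + T.push biprod.inr δ₂) = δ₁ := by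
    simp [← push_comp]
  have hsnd : T.push biprod.snd (T.push biprod.inl δ₁ + T.push biprod.inr δ₂) = δ₂ := by
    simp [← push_comp]
  obtain ⟨e₂, hme₂, hey₂, H₂⟩ := exists_quotient_by_summand (realizes_inr_fst A₁ A₂)
    (r := biprod.snd) (by simp) hμ (hfst.symm ▸ h₁)
  obtain ⟨e₁, hme₁, hey₁, H₁⟩ := exists_quotient_by_summand (T.realizes_zero A₁ A₂)
    (r := biprod.fst) (by simp) hμ (hsnd.symm ▸ h₂)
  rw [hsnd] at H₂
  rw [hfst] at H₁
  exact ⟨M, biprod.inl ≫ m, e₁, biprod.inr ≫ m, e₂, by simp [hme₁], by simp [hme₂],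
    hey₂.trans hey₁.symm, H₁, H₂⟩

/-! ### Exactness under base change. -/

section BaseChange

variable {A B D B' D' : C} {x : A ⟶ B} {y : B ⟶ D} {δ : T.Ext D A} {x' : A ⟶ B'} {y' : B' ⟶ D'}

lemma covExactAt_base_change (h : T.Realizes x y δ) {c : D' ⟶ D}
    (h' : T.Realizes x' y' (T.pull c δ)) {P : C} (hP : CovExactAt P x y) :
    CovExactAt P x' y' := by
  rw [covExactAt_iff h] at hP
  rw [covExactAt_iff h']
  refine ⟨fun t ht => hP.1 t ?_, fun t => by rw [← pull_comp, hP.2]⟩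
  obtain ⟨b, hb, -⟩ := T.realization h' h (𝟙 A) c (by simp)
  rw [← Category.id_comp x, ← hb, reassoc_of% ht, zero_comp]

/-- The base change square gives an E-triangle `B' ⟶ B ⊞ D' ⟶ D` with deflation `(y, -c)`. If `y' ≫
t = 0`, then `biprod.snd ≫ t` factors through it via some `ψ` with `y ≫ ψ = 0`, so `ψ = 0` and `t =
0`. -/
lemma contraExactAt_base_change (h : T.Realizes x y δ) {c : D' ⟶ D}
    (h' : T.Realizes x' y' (T.pull c δ)) {I : C} (hI : ContraExactAt I x y) :
    ContraExactAt I x' y' := by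
  rw [contraExactAt_iff h] at hI
  rw [contraExactAt_iff h']
  refine ⟨fun t ht => ?_, fun t => by rw [push_pull, hI.2, pull_zero]⟩
  obtain ⟨H, h'', d, e, δ'', hd, -, hδ'', hed, -, -⟩ :=
    T.et4_op (realizes_graph c) (realizes_sum_id h D')
  rw [← pull_comp, biprod.lift_fst] at hed
  obtain ⟨b, -, hb⟩ := hed.exists_iso h'
  have hd' : h'' ≫ biprod.snd = d := by
    have := hd =≫ biprod.snd
    simpa using this
  obtain ⟨ψ, hψ⟩ := exists_desc hδ'' (biprod.snd ≫ t)
    (by rw [reassoc_of% hd', ← hb, Category.assoc, ht, comp_zero])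
  have hψ₁ : y ≫ ψ = 0 := by
    have := biprod.inl ≫= hψ
    simpa using this
  have hψ₂ := biprod.inr ≫= hψ
  simpa [hI.1 ψ hψ₁] using hψ₂.symm

end BaseChange

/-! ### Exactness under composition of deflations. -/

section Composition

variable {A B D F G N : C} {f' : D ⟶ B} {f : B ⟶ A} {δ : T.Ext A D} {g' : F ⟶ G} {g : G ⟶ B}
  {δ' : T.Ext B F} {h' : N ⟶ G} {d : N ⟶ D} {e : F ⟶ N} {δ'' : T.Ext A N}

lemma covExactAt_comp (hf : T.Realizes f' f δ) (hg : T.Realizes g' g δ')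
    (hd : h' ≫ g = d ≫ f') (he : e ≫ h' = g') (hN : T.Realizes h' (g ≫ f) δ'')
    (hed : T.Realizes e d (T.pull f' δ')) {P : C} (hfP : CovExactAt P f' f)
    (hgP : CovExactAt P g' g) : CovExactAt P h' (g ≫ f) := by
  refine (covExactAt_iff hN P).2 ⟨fun t ht => ?_, fun t => (exists_lift_iff hN t).1 ?_⟩
  · rw [covExactAt_iff hf] at hfP
    rw [covExactAt_iff hg] at hgP
    obtain ⟨l, rfl⟩ := exists_lift hed t (hfP.1 _ (by rw [Category.assoc, ← hd, reassoc_of% ht,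
      zero_comp]))
    rw [hgP.1 l (by rw [← he, ← ht, Category.assoc]), zero_comp]
  · obtain ⟨s, hs⟩ := hfP.2.2 t
    obtain ⟨r, hr⟩ := hgP.2.2 s
    exact ⟨r, by simpa [← hr] using hs⟩

lemma contraExactAt_comp (hf : T.Realizes f' f δ) (hg : T.Realizes g' g δ')
    (hd : h' ≫ g = d ≫ f') (he : e ≫ h' = g') (hN : T.Realizes h' (g ≫ f) δ'')
    (hed : T.Realizes e d (T.pull f' δ')) {I : C} (hfI : ContraExactAt I f' f)
    (hgI : ContraExactAt I g' g) : ContraExactAt I h' (g ≫ f) := by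
  refine (contraExactAt_iff hN I).2 ⟨fun t ht => ?_, fun t => (exists_extend_iff hN t).1 ?_⟩
  · rw [contraExactAt_iff hf] at hfI
    rw [contraExactAt_iff hg] at hgI
    exact hfI.1 t (hgI.1 _ (by simpa using ht))
  · obtain ⟨r, hr⟩ := hgI.2.2 (e ≫ t)
    obtain ⟨k, hk⟩ := exists_desc hed (t - h' ≫ r) (by
      simp only at hr
      rw [Preadditive.comp_sub, reassoc_of% he, hr, sub_self])
    obtain ⟨k', hk'⟩ := hfI.2.2 k
    refine ⟨r + g ≫ k', ?_⟩
    simp only at hk'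
    rw [Preadditive.comp_add, reassoc_of% hd, hk', hk]
    abel

end Composition

end Extriangulated

open Extriangulated

namespace ProperClass

variable (ξ : ProperClass T)

/-- `ξ`-deflations are closed under composition. -/
lemma mem_comp {A B D F G N : C} {f' : D ⟶ B} {f : B ⟶ A} {δ : T.Ext A D} {g' : F ⟶ G} {g : G ⟶ B}
    {δ' : T.Ext B F} {h' : N ⟶ G} {e : F ⟶ N} {δ'' : T.Ext A N}
    (hf : ξ.mem f' f δ) (hg : ξ.mem g' g δ') (hN : T.Realizes h' (g ≫ f) δ'')
    (hpull : T.pull f δ'' = T.push e δ') : ξ.mem h' (g ≫ f) δ'' := by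
  obtain ⟨M, m₁, e₁, m₂, e₂, hm₂, hm₁, hsq, H₁, H₂⟩ := exists_pullback_square hN (ξ.realizes hf)
  -- Saturation reduces the claim to `f^* δ''`, which is the cobase change `e_* δ'`.
  refine ξ.saturated hN (ξ.realizes hf) hm₂ hm₁ hsq H₁ H₂ hf ?_
  rw [hpull] at H₁ ⊢
  exact ξ.cobase_change e hg H₁

/-- The `E`-triangles in `ξ` which are `C(𝒲, -)`-exact and, if `H` holds, also
`C(-, 𝒲)`-exact. -/
def BiExact (𝒲 : ObjectProperty C) (H : Prop) {A B D : C} (x : A ⟶ B) (y : B ⟶ D)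
    (δ : T.Ext D A) : Prop :=
  ξ.CovExact 𝒲 x y δ ∧ (H → ξ.ContraExact 𝒲 x y δ)

variable {ξ} {𝒲 : ObjectProperty C} {H : Prop}

namespace BiExact

lemma mem {A B D : C} {x : A ⟶ B} {y : B ⟶ D} {δ : T.Ext D A} (h : ξ.BiExact 𝒲 H x y δ) :
    ξ.mem x y δ := h.1.1

lemma realizes {A B D : C} {x : A ⟶ B} {y : B ⟶ D} {δ : T.Ext D A} (h : ξ.BiExact 𝒲 H x y δ) :
    T.Realizes x y δ := ξ.realizes h.mem

lemma base_change {A B D B' D' : C} {x : A ⟶ B} {y : B ⟶ D} {δ : T.Ext D A} {x' : A ⟶ B'}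
    {y' : B' ⟶ D'} (h : ξ.BiExact 𝒲 H x y δ) {c : D' ⟶ D}
    (h' : T.Realizes x' y' (T.pull c δ)) : ξ.BiExact 𝒲 H x' y' (T.pull c δ) :=
  ⟨⟨ξ.base_change c h.mem h', fun W hW => covExactAt_base_change h.realizes h' (h.1.2 W hW)⟩,
    fun hH => ⟨ξ.base_change c h.mem h', fun W hW =>
      contraExactAt_base_change h.realizes h' ((h.2 hH).2 W hW)⟩⟩

/-- The composite of the deflations of two exact `E`-triangles is the deflation of an exact
`E`-triangle. -/
lemma exists_comp {A B D F G : C} {f' : D ⟶ B} {f : B ⟶ A} {δ : T.Ext A D} {g' : F ⟶ G}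
    {g : G ⟶ B} {δ' : T.Ext B F} (hf : ξ.BiExact 𝒲 H f' f δ) (hg : ξ.BiExact 𝒲 H g' g δ') :
    ∃ (N : C) (h' : N ⟶ G) (d : N ⟶ D) (e : F ⟶ N) (δ'' : T.Ext A N),
      ξ.BiExact 𝒲 H h' (g ≫ f) δ'' ∧ ξ.BiExact 𝒲 H e d (T.pull f' δ') := by
  obtain ⟨N, h', d, e, δ'', hd, he, hN, hed, -, hpull⟩ := T.et4_op hf.realizes hg.realizes
  have hmem := ξ.mem_comp hf.mem hg.mem hN hpull
  exact ⟨N, h', d, e, δ'', ⟨⟨hmem, fun W hW => covExactAt_comp hf.realizes hg.realizes hd he hN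
    hed (hf.1.2 W hW) (hg.1.2 W hW)⟩, fun hH => ⟨hmem, fun W hW => contraExactAt_comp hf.realizes
    hg.realizes hd he hN hed ((hf.2 hH).2 W hW) ((hg.2 hH).2 W hW)⟩⟩, hg.base_change hed⟩

/-- The horseshoe lemma. -/
lemma exists_horseshoe {A B D K_A P_A K_D P_D : C} {x : A ⟶ B} {y : B ⟶ D} {δ : T.Ext D A}
    (h : ξ.BiExact 𝒲 H x y δ) {i_A : K_A ⟶ P_A} {p_A : P_A ⟶ A} {δ_A : T.Ext A K_A}
    (h_A : ξ.BiExact 𝒲 H i_A p_A δ_A) {i_D : K_D ⟶ P_D} {p_D : P_D ⟶ D} {δ_D : T.Ext D K_D}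
    (h_D : ξ.BiExact 𝒲 H i_D p_D δ_D) (hP : 𝒲 P_D) :
    ∃ (N : C) (g : N ⟶ P_A ⊞ P_D) (f : P_A ⊞ P_D ⟶ B) (ρ : T.Ext B N) (e : K_A ⟶ N) (d : N ⟶ K_D)
      (σ : T.Ext K_D K_A), ξ.BiExact 𝒲 H g f ρ ∧ ξ.BiExact 𝒲 H e d σ := by
  obtain ⟨M, m₁, e₁, m₂, e₂, -, -, -, H₁, H₂⟩ := exists_pullback_square h.realizes h_D.realizes
  -- As `P_D` lies in `𝒲`, `p_D` lifts to `B`, so the pullback is `A ⊞ P_D`. It is covered by `P_A ⊞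
  -- P_D` and in turn covers `B`.
  rw [((covExactAt_iff h.realizes P_D).1 (h.1.2 P_D hP)).2 p_D] at H₁
  obtain ⟨b, -, -⟩ := H₁.exists_iso (T.realizes_zero A P_D)
  have H₃ : T.Realizes (m₂ ≫ b.hom) (b.inv ≫ e₂) (T.pull y δ_D) :=
    H₂.of_mid_iso b rfl (by simp)
  obtain ⟨N, g, d, e, ρ, hN, hde⟩ := (h_D.base_change H₃).exists_comp
    (h_A.base_change (realizes_sum_id h_A.realizes P_D))
  exact ⟨N, g, _, ρ, e, d, _, hN, hde⟩

end BiExact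

end ProperClass

/-! ### Comparing two splicings of one complex. -/

variable {ξ : ProperClass T} {𝒲 : ObjectProperty C} {H : Prop}

/-- `C(-, 𝒲)`-exactness of an `E`-triangle in `ξ` only depends on its deflation, up to
isomorphism of the target. -/
lemma ProperClass.ContraExact.of_deflation {A A' B D D' : C} {x : A ⟶ B} {y : B ⟶ D}
    {δ : T.Ext D A} {x' : A' ⟶ B} {y' : B ⟶ D'} {δ' : T.Ext D' A'} (h' : ξ.ContraExact 𝒲 x' y' δ')
    (h : ξ.mem x y δ) (c : D ≅ D') (hc : y ≫ c.hom = y') : ξ.ContraExact 𝒲 x y δ := by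
  refine ⟨h, fun I hI => ?_⟩
  obtain ⟨a, -, ha⟩ := exists_left_iso (ξ.realizes h) (ξ.realizes h'.1) c hc
  have hI' := (contraExactAt_iff (ξ.realizes h'.1) I).1 (h'.2 I hI)
  refine (contraExactAt_iff (ξ.realizes h) I).2 ⟨fun t ht => ?_, fun t => ?_⟩
  · have := hI'.1 (c.inv ≫ t) (by simp [← hc, ht])
    simpa using c.hom ≫= this
  · have hδ : δ = T.push a.inv (T.pull c.hom δ') := by rw [← ha, ← push_comp]; simp
    rw [hδ, ← push_comp, push_pull, hI'.2, pull_zero]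

namespace AugComplex

/-- A proper resolution is spliced from exact `E`-triangles which are `C(-, 𝒲)`-exact if the
resolution is. -/
lemma IsProperResolution.splicedFrom_biExact {X : ℕ → C} {A : C} {R : AugComplex X A}
    (hR : R.IsProperResolution ξ 𝒲) (hH : H → R.ContraExact ξ 𝒲) :
    R.SplicedFrom (T := T) (fun x y δ => ξ.BiExact 𝒲 H x y δ) := by
  obtain ⟨hX, K, g, f, δ₀, δ, h₀, h, hd⟩ := hR
  refine ⟨K, g, f, δ₀, δ, ⟨h₀, fun hh => ?_⟩, fun n => ⟨h n, fun hh => ?_⟩, hd⟩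
  · obtain ⟨K', g', f', δ₀', δ', h₀', h', hd'⟩ := hH hh
    exact h₀'.of_deflation h₀.1 (Iso.refl _) (by simp)
  · obtain ⟨K', g', f', δ₀', δ', h₀', h', hd'⟩ := hH hh
    -- The second splicing may use other syzygies. Cancelling `g n` on maps from `X (n + 1)`, an
    -- object of `𝒲`, shows that the differentials determine `f n`, so the syzygies agree
    -- inductively.
    have hg : ∀ n, Function.Injective (fun t : X (n + 1) ⟶ K n => t ≫ g n)
      | 0 => (h₀.2 _ (hX _)).1
      | n + 1 => ((h n).2 _ (hX _)).1
    have hf : ∀ n (a : K n ≅ K' n), a.hom ≫ g' n = g n → f n ≫ a.hom = f' n := by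
      intro n a ha
      rw [← Iso.eq_comp_inv]
      refine hg n ?_
      simp only [Category.assoc]
      rw [← hd, hd', ← ha, Iso.inv_hom_id_assoc]
    have key : ∀ n, ∃ a : K n ≅ K' n, a.hom ≫ g' n = g n := by
      intro n
      induction n with
      | zero =>
        obtain ⟨a, ha, -⟩ := exists_left_iso (ξ.realizes h₀.1) (ξ.realizes h₀'.1) (Iso.refl _)
          (by simp)
        exact ⟨a, ha⟩
      | succ n ih =>
        obtain ⟨a, ha⟩ := ih
        obtain ⟨b, hb, -⟩ := exists_left_iso (ξ.realizes (h n).1) (ξ.realizes (h' n).1) a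
          (hf n a ha)
        exact ⟨b, hb⟩
    obtain ⟨a, ha⟩ := key n
    exact (h' n).of_deflation (h n).1 a (hf n a ha)

end AugComplex

/-! ### Assembling the resolution. -/

/-- An `E`-triangle with prescribed end terms which is exact in the sense of
`ProperClass.BiExact`. -/
structure BiExactTriangle (ξ : ProperClass T) (𝒲 : ObjectProperty C) (H : Prop) (A D : C) where
  /-- the middle term -/
  mid : C
  /-- the inflation -/
  x : A ⟶ mid
  /-- the deflation -/
  y : mid ⟶ D
  /-- the extension -/
  δ : T.Ext D A
  biExact : ξ.BiExact 𝒲 H x y δ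

/-- Splicing: an exact `E`-triangle `N 0 ⟶ Y 0 ⟶ A` followed by exact `E`-triangles
`N (n + 1) ⟶ Y (n + 1) ⟶ N n` form a complex. -/
lemma exists_augComplex {Y : ℕ → C} {A : C} (N : ℕ → C) (g : ∀ n, N n ⟶ Y n) (ε : Y 0 ⟶ A)
    (f : ∀ n, Y (n + 1) ⟶ N n) {δ₀ : T.Ext A (N 0)} {δ : ∀ n, T.Ext (N n) (N (n + 1))}
    (h₀ : ξ.BiExact 𝒲 H (g 0) ε δ₀) (h : ∀ n, ξ.BiExact 𝒲 H (g (n + 1)) (f n) (δ n)) :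
    ∃ R : AugComplex Y A, R.CovExact ξ 𝒲 ∧ (H → R.ContraExact ξ 𝒲) := by
  refine ⟨⟨fun n => f n ≫ g n, ε, fun n => ?_, ?_⟩, ⟨N, g, f, δ₀, δ, h₀.1, fun n => (h n).1,
    fun _ => rfl⟩, fun hH => ⟨N, g, f, δ₀, δ, h₀.2 hH, fun n => (h n).2 hH, fun _ => rfl⟩⟩
  · rw [Category.assoc, reassoc_of% comp_eq_zero (h n).realizes, zero_comp, comp_zero]
  · rw [Category.assoc, comp_eq_zero h₀.realizes, comp_zero]

/-- Iterated horseshoe: exact `E`-triangles `A (n + 1) ⟶ P n ⟶ A n` and `D (n + 1) ⟶ Q n ⟶ D n`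
and an exact `E`-triangle `A 0 ⟶ N ⟶ D 0` yield exact `E`-triangles
`N (n + 1) ⟶ P n ⊞ Q n ⟶ N n` with `N 0 = N`. -/
lemma exists_horseshoe_sequence {A D P Q : ℕ → C} {i : ∀ n, A (n + 1) ⟶ P n}
    {p : ∀ n, P n ⟶ A n} {α : ∀ n, T.Ext (A n) (A (n + 1))}
    (hA : ∀ n, ξ.BiExact 𝒲 H (i n) (p n) (α n))
    {j : ∀ n, D (n + 1) ⟶ Q n} {q : ∀ n, Q n ⟶ D n} {β : ∀ n, T.Ext (D n) (D (n + 1))}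
    (hD : ∀ n, ξ.BiExact 𝒲 H (j n) (q n) (β n)) (hQ : ∀ n, 𝒲 (Q n))
    (t : BiExactTriangle ξ 𝒲 H (A 0) (D 0)) :
    ∃ (N : ℕ → C) (g : ∀ n, N (n + 1) ⟶ P n ⊞ Q n) (f : ∀ n, P n ⊞ Q n ⟶ N n)
      (ρ : ∀ n, T.Ext (N n) (N (n + 1))), N 0 = t.mid ∧ ∀ n, ξ.BiExact 𝒲 H (g n) (f n) (ρ n) := by
  -- The recursion carries the whole triangle `A n ⟶ N n ⟶ D n`, because the next horseshoe needs
  -- it.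
  have step : ∀ n (s : BiExactTriangle ξ 𝒲 H (A n) (D n)),
      ∃ (s' : BiExactTriangle ξ 𝒲 H (A (n + 1)) (D (n + 1))) (g : s'.mid ⟶ P n ⊞ Q n)
        (f : P n ⊞ Q n ⟶ s.mid) (ρ : T.Ext s.mid s'.mid), ξ.BiExact 𝒲 H g f ρ := by
    intro n s
    obtain ⟨N, g, f, ρ, e, d, σ, h, h'⟩ := s.biExact.exists_horseshoe (hA n) (hD n) (hQ n)
    exact ⟨⟨N, e, d, σ, h'⟩, g, f, ρ, h⟩
  choose next g f ρ h using step
  let s : ∀ n, BiExactTriangle ξ 𝒲 H (A n) (D n) := fun n => Nat.rec t (fun n s => next n s) n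
  exact ⟨fun n => (s n).mid, fun n => g n (s n), fun n => f n (s n), fun n => ρ n (s n), rfl,
    fun n => h n (s n)⟩

end Extri

theorem mainTheorem2
    {C : Type u} [Category.{v} C] [Preadditive C] [HasZeroObject C] [HasBinaryBiproducts C]
    (T : Extri.Extriangulated.{w} C) (hWIC : T.WIC)
    (ξ : Extri.ProperClass T) (hproj : ξ.EnoughProjectives) (hinj : ξ.EnoughInjectives)
    (𝒲 : ObjectProperty C) (hsum : Extri.ClosedUnderSums 𝒲) (hker : ξ.ClosedUnderHokernels 𝒲)
    {X X₀ X₁ : C} (x : X ⟶ X₀) (y : X₀ ⟶ X₁) (δ : T.Ext X₁ X) (hδ : ξ.mem x y δ)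
    (W₀ W₁ : ℕ → C) (R₀ : Extri.AugComplex W₀ X₀) (R₁ : Extri.AugComplex W₁ X₁)
    (hR₀ : R₀.IsProperResolution ξ 𝒲) (hR₁ : R₁.IsProperResolution ξ 𝒲) :
    ∃ (W : C) (R : Extri.AugComplex (Extri.shiftedTerms W W₁ W₀) X),
      R.IsProperResolution ξ 𝒲 ∧
      (∃ (i : W ⟶ W₁ 1 ⊞ W₀ 0) (p : W₁ 1 ⊞ W₀ 0 ⟶ W₁ 0) (ρ : T.Ext (W₁ 0) W), ξ.mem i p ρ) ∧
      (R₀.ContraExact ξ 𝒲 → R₁.ContraExact ξ 𝒲 → ξ.ContraExact 𝒲 x y δ →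
        R.ContraExact ξ 𝒲) := by
  let H : Prop := R₀.ContraExact ξ 𝒲 ∧ R₁.ContraExact ξ 𝒲
  obtain ⟨K₀, g₀, f₀, ε₀, δ₀, hε₀, hδ₀, -⟩ := hR₀.splicedFrom_biExact (H := H) And.left
  obtain ⟨K₁, g₁, f₁, ε₁, δ₁, hε₁, hδ₁, -⟩ := hR₁.splicedFrom_biExact (H := H) And.right
  obtain ⟨M, m₁, e₁, m₂, e₂, -, -, -, H₁, H₂⟩ :=
    Extri.Extriangulated.exists_pullback_square (ξ.realizes hδ) hε₁.realizes
  have hM := ξ.base_change _ hδ H₁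
  obtain ⟨N, g, f, ρ, e, d, σ, hN, hed⟩ :=
    (hε₁.base_change H₂).exists_horseshoe (hδ₁ 0) hε₀ (hR₀.1 0)
  -- `hW` is the triangle of (a); `hWX` is `N ⟶ W ⟶ X`, the base change of `hN` along `m₁`.
  obtain ⟨W, i, c, k, τ, -, -, hW, hWX, -, hpull⟩ := T.et4_op H₁ hN.realizes
  have hmem := ξ.mem_comp hM hN.mem hW hpull
  -- `W₁ 0`, `W₁ 1` and `W₀ 0` are already used, so the left end of `N` starts at `K₁ 1` and the
  -- right end at `K₀ 0`.
  obtain ⟨N', g', f', ρ', hN₀, hN'⟩ := Extri.exists_horseshoe_sequence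
    (A := fun n => K₁ (n + 1)) (D := K₀) (fun n => hδ₁ (n + 1)) hδ₀ (fun n => hR₀.1 (n + 1))
    ⟨N, e, d, σ, hed⟩
  obtain rfl : N' 0 = N := hN₀
  obtain ⟨R, hR, hR'⟩ := Extri.exists_augComplex (Y := Extri.shiftedTerms W W₁ W₀) N'
    (fun n => match n with
      | 0 => k
      | n + 1 => g' n) c f' (hN.base_change hWX) hN'
  refine ⟨W, R, ⟨fun n => ?_, hR⟩, ⟨i, _, τ, hmem⟩, fun h₀ h₁ _ => hR' ⟨h₀, h₁⟩⟩
  cases n with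
  | zero => exact hker _ _ _ hmem (hsum.2 _ _ (hR₁.1 1) (hR₀.1 0)) (hR₁.1 0)
  | succ n => exact hsum.2 _ _ (hR₁.1 (n + 2)) (hR₀.1 (n + 1))
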